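/- **Setting.** Fix an integer $L\ge 2$ and reals $0<\lambda<1$, $\sigma^2>0$, $P_p>0$, $P_{\max}>0$, $\theta_p>0$, $\theta_s>0$; put $\gamma_p=P_p/\sigma^2$ and $\gamma_{\max}=P_{\max}/\sigma^2$. A primary user (PU) link with one antenna at each end coexists with a secondary user (SU) link with $L$ transmit antennas and one receive antenna. The PU channel $h_p\sim\mathcal{CN}(0,1)$, the SU channel $\mathbf h_s\in\mathbb C^L$ with i.i.d. $\mathcal{CN}(0,1)$ entries, and the channel $\mathbf h_x\in\mathbb C^L$ from the SU transmitter to the PU receiver with i.i.d. $\mathcal{CN}(0,\lambda)$ entries are independent. Write $g_p=|h_p|^2$, $g_s=\|\mathbf h_s\|^2$, $\mathbf s_s=\mathbf h_s/\|\mathbf h_s\|$, $g_x=\|\mathbf h_x\|^2/\lambda$, $\mathbf s_x=\mathbf h_x/\|\mathbf h_x\|$. *Channel-direction feedback with $B$ bits.* The PU receiver feeds back a unit vector $\hat{\mathbf s}_x=Q(\mathbf s_x,U)$, where $Q$ is a measurable quantizer and $U$ is a random element (a randomization of the quantizer, possibly trivial) independent of $(h_p,\mathbf h_s,\mathbf h_x)$.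 The quantization error $\epsilon=1-|\hat{\mathbf s}_x^\dagger\mathbf s_x|^2$ is assumed to satisfy $\Pr(\epsilon\le\tau)=2^B\tau^{L-1}$ for $0\le\tau\le 2^{-B/(L-1)}$. *Perfect interference-power-control feedback, without feedforward.* Let $\omega=\sigma^2(\gamma_pg_p/\theta_p-1)$, and let $\eta=\omega/(\lambda g_x\epsilon)$ if $\omega\ge 0$ and $\eta=P_{\max}$ otherwise. The allowed SU power is $\hat\eta=\eta$ if $\omega\ge0$ and $\eta<P_{\max}$, and $\hat\eta=P_{\max}$ otherwise. *Orthogonal cognitive beamforming.* Almost surely the SU beamformer $\mathbf f\in\mathbb C^L$ maximizes $|\mathbf f^\dagger\mathbf s_s|^2$ subject to $\mathbf f^\dagger\hat{\mathbf s}_x=0$ and $\|\mathbf f\|^2\le\hat\eta$. The SU outage probability is $P_{\rm out}=\Pr(\mathsf{SNR}_s\le\theta_s)$ with $\mathsf{SNR}_s=\frac{g_s}{\sigma^2}|\mathbf f^\dagger\mathbf s_s|^2$. **Theorem.** With $\Gamma(a,x)=\int_x^\infty t^{a-1}e^{-t}\,dt$ $(x>0)$ and $$\varphi=e^{-\theta_p/\gamma_p}\,\frac{(L-1)\,\lambda\,\theta_p\,\theta_s\,\Gamma\!\left(L-2,\frac{\theta_s}{\gamma_{\max}}\right)}{\gamma_p\,\Gamma(L-1)},$$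 one has $$P_{\rm out}=1-\frac{\Gamma\!\left(L-1,\frac{\theta_s}{\gamma_{\max}}\right)}{\Gamma(L-1)}+\varphi\,2^{-\frac{B}{L-1}}+O\!\left(2^{-\frac{2B}{L-1}}\right),$$ where the constant in $O(\cdot)$ depends only on $L,\lambda,\sigma^2,P_p,P_{\max},\theta_p,\theta_s$, and the bound holds for every integer $B\ge 0$. -/

import Mathlib

open MeasureTheory ProbabilityTheory

universe u v

noncomputable section

/-- The circularly symmetric complex Gaussian law `CN(0, s)`: real and imaginary parts are
independent real Gaussians with mean `0` and variance `s / 2`. -/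
def complexGaussian (s : ℝ) : Measure ℂ :=
  ((gaussianReal 0 (s / 2).toNNReal).prod (gaussianReal 0 (s / 2).toNNReal)).map
    (fun z : ℝ × ℝ => (⟨z.1, z.2⟩ : ℂ))

/-- The law on `ℂ^L` (Euclidean norm) of a vector with i.i.d. `CN(0, s)` entries. -/
def complexGaussianVector (L : ℕ) (s : ℝ) : Measure (EuclideanSpace ℂ (Fin L)) :=
  (Measure.pi (fun _ : Fin L => complexGaussian s)).map (fun x => WithLp.toLp 2 x)

/-- The upper incomplete gamma function `Γ(a, x) = ∫_x^∞ t^(a-1) e^(-t) dt`, for `x > 0`. -/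
def upperGamma (a x : ℝ) : ℝ := ∫ t in Set.Ioi x, t ^ (a - 1) * Real.exp (-t)

/-- The shape (direction) `h / ‖h‖` of a channel vector. -/
def channelShape {L : ℕ} (h : EuclideanSpace ℂ (Fin L)) : EuclideanSpace ℂ (Fin L) :=
  ((‖h‖⁻¹ : ℝ) : ℂ) • h

/-- The parameters of the cognitive radio network. -/
structure CRParams where
  /-- number of antennas of the secondary transmitter -/
  L : ℕ
  /-- variance of the entries of the channel from the secondary transmitter
  to the primary receiver -/
  lam : ℝ
  /-- noise variance `σ²` -/
  noise : ℝ
  /-- transmission power of the primary transmitter -/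
  Pp : ℝ
  /-- maximum transmission power of the secondary transmitter -/
  Pmax : ℝ
  /-- SINR threshold of the primary link -/
  thetaP : ℝ
  /-- SNR threshold of the secondary link -/
  thetaS : ℝ
  two_le_L : 2 ≤ L
  lam_pos : 0 < lam
  lam_lt_one : lam < 1
  noise_pos : 0 < noise
  Pp_pos : 0 < Pp
  Pmax_pos : 0 < Pmax
  thetaP_pos : 0 < thetaP
  thetaS_pos : 0 < thetaS

namespace CRParams

/-- Primary transmit SNR. -/
def gammaP (p : CRParams) : ℝ := p.Pp / p.noise

/-- Maximum secondary transmit SNR. -/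
def gammaMax (p : CRParams) : ℝ := p.Pmax / p.noise

/-- The coefficient `φ` of the first-order term. -/
def phi (p : CRParams) : ℝ :=
  Real.exp (-(p.thetaP / p.gammaP)) *
    ((((p.L : ℝ) - 1) * p.lam * p.thetaP * p.thetaS *
        upperGamma ((p.L : ℝ) - 2) (p.thetaS / p.gammaMax)) /
      (p.gammaP * Real.Gamma ((p.L : ℝ) - 1)))

/-- The margin `σ² (γ_p g / θ_p - 1)`: the largest interference power that the primary receiver
tolerates when the primary channel power is `g`; it is negative when that receiver is in outage
without any interference. -/
def margin (p : CRParams) (g : ℝ) : ℝ := p.noise * (p.gammaP * g / p.thetaP - 1)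

/-- The unquantized interference-power-control signal without feedforward, for primary channel
power `g`, gain `gx` of the channel from the secondary transmitter to the primary receiver, and
quantization error `e`. -/
def ipc (p : CRParams) (g gx e : ℝ) : ℝ :=
  if 0 ≤ p.margin g then p.margin g / (p.lam * gx * e) else p.Pmax

/-- The transmission power allowed by perfect feedback of the interference-power-control signal:
the signal itself if it is relevant and smaller than `Pmax`, and `Pmax` otherwise. -/
def powerLimit (p : CRParams) (g gx e : ℝ) : ℝ :=
  if 0 ≤ p.margin g ∧ p.ipc g gx e < p.Pmax then p.ipc g gx e else p.Pmax

end CRParams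

/-- The feasible set of orthogonal cognitive beamforming: vectors orthogonal to the fed back
direction `shat` whose power `‖f‖²` is at most `P`. -/
def ocbFeasible {L : ℕ} (shat : EuclideanSpace ℂ (Fin L)) (P : ℝ) :
    Set (EuclideanSpace ℂ (Fin L)) :=
  {f | inner ℂ f shat = 0 ∧ ‖f‖ ^ 2 ≤ P}

/-- `f` is an orthogonal cognitive beamformer: it maximizes `|f† s|²` over the feasible set, where
`s` is the shape of the secondary channel. -/
def IsOCB {L : ℕ} (shat s : EuclideanSpace ℂ (Fin L)) (P : ℝ)
    (f : EuclideanSpace ℂ (Fin L)) : Prop :=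
  f ∈ ocbFeasible shat P ∧ IsMaxOn (fun w => ‖inner ℂ w s‖ ^ 2) (ocbFeasible shat P) f

/-- The channels, the channel-direction feedback and the beamformer, as random variables on a
probability space `(Ω, μ)`. The quantizer sees only the direction of the channel `hx`, and a
source of randomness `U` with values in `V` (for instance a random codebook) that is independent of
all the channels; a deterministic quantizer is the case where `V` is a point. -/
structure OCBLink (p : CRParams) {Ω : Type u} [MeasurableSpace Ω] (μ : Measure Ω)
    (V : Type v) [MeasurableSpace V] where
  /-- channel from the primary transmitter to the primary receiver -/
  hp : Ω → ℂ
  /-- channel from the secondary transmitter to the secondary receiver -/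
  hs : Ω → EuclideanSpace ℂ (Fin p.L)
  /-- channel from the secondary transmitter to the primary receiver -/
  hx : Ω → EuclideanSpace ℂ (Fin p.L)
  /-- randomness of the quantizer -/
  U : Ω → V
  /-- the direction quantizer -/
  Q : EuclideanSpace ℂ (Fin p.L) → V → EuclideanSpace ℂ (Fin p.L)
  /-- the beamformer -/
  f : Ω → EuclideanSpace ℂ (Fin p.L)
  law_hp : HasLaw hp (complexGaussian 1) μ
  law_hs : HasLaw hs (complexGaussianVector p.L 1) μ
  law_hx : HasLaw hx (complexGaussianVector p.L p.lam) μ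
  measurable_U : Measurable U
  measurable_Q : Measurable (Function.uncurry Q)
  /-- Together with the next two fields: `hp`, `hs`, `hx`, `U` are mutually independent. -/
  indep_hp : IndepFun hp (fun ω => (hs ω, hx ω, U ω)) μ
  indep_hs : IndepFun hs (fun ω => (hx ω, U ω)) μ
  indep_hx : IndepFun hx U μ
  /-- The fed back direction is a unit vector. -/
  norm_Q : ∀ᵐ ω ∂μ, ‖Q (channelShape (hx ω)) (U ω)‖ = 1
  /-- The beamformer is the orthogonal cognitive beamformer under perfect
  interference-power-control feedback. -/
  isOCB : ∀ᵐ ω ∂μ,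
    IsOCB (Q (channelShape (hx ω)) (U ω)) (channelShape (hs ω))
      (p.powerLimit (‖hp ω‖ ^ 2) (‖hx ω‖ ^ 2 / p.lam)
        (1 - ‖inner ℂ (Q (channelShape (hx ω)) (U ω)) (channelShape (hx ω))‖ ^ 2))
      (f ω)

namespace OCBLink

variable {p : CRParams} {Ω : Type u} [MeasurableSpace Ω] {μ : Measure Ω}
  {V : Type v} [MeasurableSpace V]

/-- The quantization error `1 - |ŝ† s|²` of the fed back channel direction. -/
def quantError (N : OCBLink p μ V) (ω : Ω) : ℝ :=
  1 - ‖inner ℂ (N.Q (channelShape (N.hx ω)) (N.U ω)) (channelShape (N.hx ω))‖ ^ 2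

/-- The `B`-bit quantization model: on `[0, 2^(-B/(L-1))]` the distribution function of the
quantization error is `2^B τ^(L-1)`. (It reaches `1` at the right end point.) -/
def IsBBitFeedback (N : OCBLink p μ V) (B : ℕ) : Prop :=
  ∀ τ : ℝ, 0 ≤ τ → τ ≤ (2 : ℝ) ^ (-((B : ℝ) / ((p.L : ℝ) - 1))) →
    μ.real {ω | N.quantError ω ≤ τ} = 2 ^ B * τ ^ (p.L - 1)

/-- The receive SNR `(g_s / σ²) |f† s_s|²` at the secondary receiver. -/
def snrS (N : OCBLink p μ V) (ω : Ω) : ℝ :=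
  ‖N.hs ω‖ ^ 2 / p.noise * ‖inner ℂ (N.f ω) (channelShape (N.hs ω))‖ ^ 2

/-- The outage probability of the secondary link. -/
def outageProb (N : OCBLink p μ V) : ℝ := μ.real {ω | N.snrS ω ≤ p.thetaS}

end OCBLink

end

/-! Put `a = θ_s/γ_max`, `b = θ_p/γ_p`, and let `G = |h_p|²`, `Y` = the power of `h_s` orthogonal to
the fed back direction, `Z = θ_s ‖h_x‖² ε`. The optimal beamformer turns the SNR into (allowed
power) · `Y` / σ², so up to a null set outage means `Y ≤ a` or `b ≤ G ≤ b (1 + Z/Y)`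
(`CRParams.outage_iff`, `ae_snrS_le_iff`).

By unitary invariance `Y` is Gamma(L-1) whatever the fed back direction, hence independent of `(h_x,
U)` (`hasLaw_orthogonal_power`), and `G` is exponential and independent of both. Given `Y > a` and
`Z`, the second event has probability `e^{-b} (1 - e^{-bZ/Y})`, which is `e^{-b} b Z/Y` up to `b² Z²
/ (2a²)` (`abs_measureReal_outage_sub_le`).

It remains to take means: `E[1_{Y>a}/Y] = Γ(L-2, a)/Γ(L-1)`. Norm and direction of `h_x` are
independent, so `E[‖h_x‖² ε] = Lλ E[ε]`. The distribution function gives `E[ε] = δ (L-1)/L` with `δ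
= 2^{-B/(L-1)}`, so the factor `L` cancels and `φ δ` appears. Since `ε ≤ δ` almost surely, the
remainder is at most a constant times `δ²`. -/

/-! ### Circular Gaussian laws: density, polar coordinates, moments. -/

section CircularGaussian

variable {E : Type*} [NormedAddCommGroup E] [InnerProductSpace ℝ E] [FiniteDimensional ℝ E]
  [MeasurableSpace E] [BorelSpace E] {μ : Measure E} {s : ℝ}

/-- A finite measure whose characteristic function is `exp (-s‖t‖²/4)` has a density proportional
to `exp (-‖x‖²/s)`. -/
theorem exists_eq_withDensity_of_charFun [IsFiniteMeasure μ] (hs : 0 < s)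
    (hμ : ∀ t, charFun μ t = Complex.exp (-(s / 4) * ‖t‖ ^ 2)) :
    ∃ c : ℝ, 0 < c ∧
      μ = volume.withDensity (fun x => ENNReal.ofReal (c * Real.exp (-s⁻¹ * ‖x‖ ^ 2))) := by
  -- `d` is the total mass of `exp (-‖x‖²/s)`, so the normalizing constant is `c = d⁻¹`.
  set d : ℝ := (Real.pi / s⁻¹) ^ (Module.finrank ℝ E / 2 : ℝ) with hd
  have hd0 : 0 < d := by positivity
  have hint : Integrable (fun x : E => d⁻¹ * Real.exp (-s⁻¹ * ‖x‖ ^ 2)) := by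
    refine Integrable.const_mul ?_ _
    have h := (GaussianFourier.integrable_cexp_neg_mul_sq_norm_add (V := E) (b := (s⁻¹ : ℝ))
      (by simpa using hs) 0 0).norm
    refine h.congr (Filter.Eventually.of_forall fun x => ?_)
    simp [Complex.norm_exp, ← Complex.ofReal_pow]
  refine ⟨d⁻¹, by positivity, ?_⟩
  have : IsFiniteMeasure (volume.withDensity
      (fun x : E => ENNReal.ofReal (d⁻¹ * Real.exp (-s⁻¹ * ‖x‖ ^ 2)))) :=
    isFiniteMeasure_withDensity_ofReal hint.2
  refine Measure.ext_of_charFun ?_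
  ext t
  rw [hμ, charFun_apply, integral_withDensity_eq_integral_toReal_smul (by fun_prop) (by simp)]
  have h := GaussianFourier.integral_cexp_neg_mul_sq_norm_add (V := E) (b := (s⁻¹ : ℝ))
      (by simpa using hs) Complex.I t
  have hd' : ((Real.pi : ℂ) / (s⁻¹ : ℝ)) ^ (Module.finrank ℝ E / 2 : ℂ) = d := by
    rw [hd, Complex.ofReal_cpow (by positivity)]
    push_cast
    rfl
  rw [hd'] at h
  have hd1 : (d : ℂ) ≠ 0 := by exact_mod_cast hd0.ne'
  calc Complex.exp (-(s / 4) * ‖t‖ ^ 2)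
      = (d : ℂ)⁻¹ * (d * Complex.exp (Complex.I ^ 2 * ‖t‖ ^ 2 / (4 * (s⁻¹ : ℝ)))) := by
        rw [inv_mul_cancel_left₀ hd1]
        congr 1
        have : (s : ℂ) ≠ 0 := by exact_mod_cast hs.ne'
        push_cast
        rw [Complex.I_sq]
        field_simp
    _ = _ := by
        rw [← h, ← integral_const_mul]
        refine integral_congr_ae (Filter.Eventually.of_forall fun x => ?_)
        simp only
        rw [ENNReal.toReal_ofReal (by positivity), Complex.real_smul, Complex.exp_add,
          real_inner_comm, mul_comm Complex.I]
        push_cast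
        ring

/-- Polar coordinates for a product of a radial function and a function of the direction. -/
theorem integral_norm_mul_direction_addHaar [Nontrivial E] (ν : Measure E) [ν.IsAddHaarMeasure]
    (g : ℝ → ℝ) (φ : E → ℝ) :
    ∫ x, g ‖x‖ * φ (‖x‖⁻¹ • x) ∂ν =
      (∫ x : Metric.sphere (0 : E) 1, φ x ∂ν.toSphere) *
        ∫ y in Set.Ioi (0 : ℝ), y ^ (Module.finrank ℝ E - 1) * g y := by
  calc
    ∫ x, g ‖x‖ * φ (‖x‖⁻¹ • x) ∂ν
      = ∫ x : ({(0)}ᶜ : Set E), g (‖x.1‖) * φ (‖x.1‖⁻¹ • x.1) ∂(ν.comap (↑)) := by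
      rw [integral_subtype_comap (measurableSet_singleton _).compl
        fun x ↦ g (‖x‖) * φ (‖x‖⁻¹ • x), restrict_compl_singleton]
    _ = ∫ x, φ x.1 * g x.2 ∂ν.toSphere.prod (.volumeIoiPow (Module.finrank ℝ E - 1)) := by
      rw [← ν.measurePreserving_homeomorphUnitSphereProd.integral_comp
        (Homeomorph.measurableEmbedding _)]
      simp [mul_comm]
    _ = (∫ x : Metric.sphere (0 : E) 1, φ x ∂ν.toSphere) *
        ∫ x : Set.Ioi (0 : ℝ), g x ∂.volumeIoiPow (Module.finrank ℝ E - 1) :=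
      integral_prod_mul (fun x : Metric.sphere (0 : E) 1 => φ x) (fun x : Set.Ioi (0 : ℝ) => g x)
    _ = _ := by
      congr 1
      simp only [Measure.volumeIoiPow, ENNReal.ofReal]
      rw [integral_withDensity_eq_integral_smul,
        integral_subtype_comap measurableSet_Ioi
          fun a ↦ Real.toNNReal (a ^ (Module.finrank ℝ E - 1)) • g a,
        setIntegral_congr_fun measurableSet_Ioi fun x hx ↦ ?_]
      · rw [NNReal.smul_def, Real.coe_toNNReal _ (pow_nonneg hx.out.le _), smul_eq_mul]
      · exact (measurable_subtype_coe.pow_const _).real_toNNReal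

/-- Under a circular Gaussian law in real dimension `2n`, the squared norm is independent of the
direction and has the Gamma law. -/
theorem integral_normSq_mul_direction [IsProbabilityMeasure μ] (hs : 0 < s)
    (hμ : ∀ t, charFun μ t = Complex.exp (-(s / 4) * ‖t‖ ^ 2)) {n : ℕ} (hn : 0 < n)
    (hdim : Module.finrank ℝ E = 2 * n) (g : ℝ → ℝ) (φ : E → ℝ) :
    ∫ x, g (‖x‖ ^ 2 / s) * φ (‖x‖⁻¹ • x) ∂μ =
      ((Real.Gamma n)⁻¹ * ∫ t in Set.Ioi (0 : ℝ), t ^ ((n : ℝ) - 1) * Real.exp (-t) * g t) *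
        ∫ x, φ (‖x‖⁻¹ • x) ∂μ := by
  have : Nontrivial E := Module.nontrivial_of_finrank_pos (R := ℝ) (by omega)
  obtain ⟨c, hc, hμc⟩ := exists_eq_withDensity_of_charFun hs hμ
  -- polar coordinates for `μ`, with radial variable `t = ‖x‖² / s`
  obtain ⟨k, hk⟩ : ∃ k : ℝ, ∀ (g : ℝ → ℝ) (φ : E → ℝ),
      ∫ x, g (‖x‖ ^ 2 / s) * φ (‖x‖⁻¹ • x) ∂μ =
        k * (∫ x : Metric.sphere (0 : E) 1, φ x ∂(volume : Measure E).toSphere) *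
        ∫ t in Set.Ioi (0 : ℝ), t ^ ((n : ℝ) - 1) * Real.exp (-t) * g t := by
    -- `c` comes from the density, and `s ^ n / 2` from `r^(2n-1) dr = (s^n / 2) t^(n-1) dt` under
    -- `r² = s t`.
    refine ⟨c * s ^ n / 2, fun g φ => ?_⟩
    have h1 : ∫ x, g (‖x‖ ^ 2 / s) * φ (‖x‖⁻¹ • x) ∂μ =
        ∫ x, (c * Real.exp (-s⁻¹ * ‖x‖ ^ 2) * g (‖x‖ ^ 2 / s)) * φ (‖x‖⁻¹ • x) := by
      conv_lhs => rw [hμc]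
      rw [integral_withDensity_eq_integral_toReal_smul (by fun_prop) (by simp)]
      refine integral_congr_ae (Filter.Eventually.of_forall fun x => ?_)
      simp only
      rw [ENNReal.toReal_ofReal (by positivity), smul_eq_mul]
      ring
    have h2 : ∫ t in Set.Ioi (0 : ℝ), t ^ ((n : ℝ) - 1) * Real.exp (-t) * g t =
        s⁻¹ * ∫ t in Set.Ioi (0 : ℝ),
          (t / s) ^ ((n : ℝ) - 1) * Real.exp (-(t / s)) * g (t / s) := by
      have := integral_comp_mul_left_Ioi
        (fun t : ℝ => t ^ ((n : ℝ) - 1) * Real.exp (-t) * g t) 0 (inv_pos.2 hs)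
      simp only [mul_zero, inv_inv, smul_eq_mul] at this
      simp only [div_eq_inv_mul, this]
      field_simp
    rw [h1, integral_norm_mul_direction_addHaar volume
      (fun r => c * Real.exp (-s⁻¹ * r ^ 2) * g (r ^ 2 / s)), h2,
      ← integral_comp_rpow_Ioi_of_pos (g := fun t =>
        (t / s) ^ ((n : ℝ) - 1) * Real.exp (-(t / s)) * g (t / s)) two_pos]
    have h3 : ∫ y in Set.Ioi (0 : ℝ), y ^ (Module.finrank ℝ E - 1) *
          (c * Real.exp (-s⁻¹ * y ^ 2) * g (y ^ 2 / s)) =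
        c * s ^ n / 2 * (s⁻¹ * ∫ x in Set.Ioi (0 : ℝ), (2 * x ^ ((2 : ℝ) - 1)) •
          ((x ^ (2 : ℝ) / s) ^ ((n : ℝ) - 1) * Real.exp (-(x ^ (2 : ℝ) / s))
            * g (x ^ (2 : ℝ) / s))) := by
      rw [← integral_const_mul, ← integral_const_mul]
      refine setIntegral_congr_fun measurableSet_Ioi fun y hy => ?_
      have hy : 0 < y := hy
      obtain ⟨m, rfl⟩ : ∃ m, n = m + 1 := ⟨n - 1, by omega⟩
      have e1 : Module.finrank ℝ E - 1 = 2 * m + 1 := by omega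
      have e2 : ((m + 1 : ℕ) : ℝ) - 1 = (m : ℕ) := by push_cast; ring
      have e3 : (2 : ℝ) - 1 = 1 := by norm_num
      have e4 : -s⁻¹ * y ^ 2 = -(y ^ 2 / s) := by ring
      simp only [e1, e2, e3, e4, Real.rpow_one, Real.rpow_two, Real.rpow_natCast, smul_eq_mul]
      rw [div_pow]
      field_simp
      ring
    rw [h3]
    ring
  have hΓ : ∫ t in Set.Ioi (0 : ℝ), t ^ ((n : ℝ) - 1) * Real.exp (-t) = Real.Gamma n := by
    rw [Real.Gamma_eq_integral (by exact_mod_cast hn)]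
    exact integral_congr_ae (Filter.Eventually.of_forall fun x => mul_comm _ _)
  have hΓ0 : Real.Gamma n ≠ 0 := (Real.Gamma_pos_of_pos (by exact_mod_cast hn)).ne'
  -- The case `g = 1` expresses `k` times the sphere integral through `∫ φ dμ` and `Γ(n)`, so
  -- neither has to be computed.
  have hφ := hk (fun _ => 1) φ
  simp only [one_mul, mul_one, hΓ] at hφ
  rw [hk, hφ]
  field_simp

theorem integral_normSq_of_charFun [IsProbabilityMeasure μ] (hs : 0 < s)
    (hμ : ∀ t, charFun μ t = Complex.exp (-(s / 4) * ‖t‖ ^ 2)) {n : ℕ} (hn : 0 < n)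
    (hdim : Module.finrank ℝ E = 2 * n) (g : ℝ → ℝ) :
    ∫ x, g (‖x‖ ^ 2 / s) ∂μ =
      (Real.Gamma n)⁻¹ * ∫ t in Set.Ioi (0 : ℝ), t ^ ((n : ℝ) - 1) * Real.exp (-t) * g t := by
  simpa using integral_normSq_mul_direction hs hμ hn hdim g (fun _ => 1)

/-- The Gamma(n) mean is `Γ(n+1)/Γ(n) = n`. This decouples the gain of `h_x` from a quantization
error that depends on its direction only. -/
theorem integral_normSq_mul_direction_eq [IsProbabilityMeasure μ] (hs : 0 < s)
    (hμ : ∀ t, charFun μ t = Complex.exp (-(s / 4) * ‖t‖ ^ 2)) {n : ℕ} (hn : 0 < n)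
    (hdim : Module.finrank ℝ E = 2 * n) (φ : E → ℝ) :
    ∫ x, ‖x‖ ^ 2 * φ (‖x‖⁻¹ • x) ∂μ = n * s * ∫ x, φ (‖x‖⁻¹ • x) ∂μ := by
  have h := integral_normSq_mul_direction hs hμ hn hdim (fun t => s * t) φ
  have hn' : (0 : ℝ) < n := by exact_mod_cast hn
  have hΓ : ∫ t in Set.Ioi (0 : ℝ), t ^ ((n : ℝ) - 1) * Real.exp (-t) * (s * t) =
      s * Real.Gamma (n + 1) := by
    rw [Real.Gamma_eq_integral (by positivity), ← integral_const_mul]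
    refine setIntegral_congr_fun measurableSet_Ioi fun y hy => ?_
    have hy : 0 < y := hy
    simp only [add_sub_cancel_right]
    rw [Real.rpow_sub_one hy.ne']
    field_simp
  rw [hΓ, Real.Gamma_add_one hn'.ne'] at h
  have hΓ0 : Real.Gamma n ≠ 0 := (Real.Gamma_pos_of_pos hn').ne'
  have e : ∀ x : E, s * (‖x‖ ^ 2 / s) = ‖x‖ ^ 2 := fun x => by field_simp
  simp only [e] at h
  rw [h]
  field_simp

/-- `μ` is the standard Gaussian scaled by `√(s/2)`, and Gaussian measures have moments of all
orders. -/
theorem integrable_norm_pow_of_charFun [IsFiniteMeasure μ] (hs : 0 < s)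
    (hμ : ∀ t, charFun μ t = Complex.exp (-(s / 4) * ‖t‖ ^ 2)) (k : ℕ) :
    Integrable (fun x => ‖x‖ ^ k) μ := by
  have h : μ = (stdGaussian E).map (fun x => √(s / 2) • x) := by
    refine Measure.ext_of_charFun ?_
    ext t
    rw [charFun_map_smul, charFun_stdGaussian, hμ, norm_smul, Real.norm_of_nonneg (by positivity)]
    congr 1
    rw [Complex.ofReal_mul, mul_pow, ← Complex.ofReal_pow √(s / 2), Real.sq_sqrt (by positivity)]
    push_cast
    ring
  rw [h, integrable_map_measure (by fun_prop) (by fun_prop)]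
  have h1 := (IsGaussian.memLp_id (stdGaussian E) (k : ENNReal) (by simp)).integrable_norm_pow'
  refine (h1.const_mul (|√(s / 2)| ^ k)).congr (Filter.Eventually.of_forall fun x => ?_)
  simp only [Function.comp_apply, norm_smul, mul_pow, Real.norm_eq_abs, id]

theorem ae_ne_zero_of_charFun [Nontrivial E] [IsFiniteMeasure μ] (hs : 0 < s)
    (hμ : ∀ t, charFun μ t = Complex.exp (-(s / 4) * ‖t‖ ^ 2)) : ∀ᵐ x ∂μ, x ≠ 0 := by
  obtain ⟨c, hc, hμc⟩ := exists_eq_withDensity_of_charFun hs hμ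
  rw [hμc]
  refine (withDensity_absolutelyContinuous _ _).ae_le ?_
  exact measure_eq_zero_iff_ae_notMem.1 (measure_singleton (0 : E))

end CircularGaussian

/-! ### Complex Gaussian vectors and their projections. -/

section ComplexGaussian

instance isProbabilityMeasure_complexGaussian (s : ℝ) :
    IsProbabilityMeasure (complexGaussian s) :=
  Measure.isProbabilityMeasure_map
    (Complex.measurableEquivRealProd.symm.measurable).aemeasurable

instance isProbabilityMeasure_complexGaussianVector (L : ℕ) (s : ℝ) :
    IsProbabilityMeasure (complexGaussianVector L s) :=
  Measure.isProbabilityMeasure_map (by fun_prop)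

theorem charFun_complexGaussian {s : ℝ} (hs : 0 < s) (t : ℂ) :
    charFun (complexGaussian s) t = Complex.exp (-(s / 4) * ‖t‖ ^ 2) := by
  have hm : Measurable (fun z : ℝ × ℝ => (⟨z.1, z.2⟩ : ℂ)) :=
    Complex.measurableEquivRealProd.symm.measurable
  have h : ∀ z : ℝ × ℝ, Complex.exp ((inner ℝ (⟨z.1, z.2⟩ : ℂ) t : ℝ) * Complex.I) =
      Complex.exp ((t.re : ℂ) * z.1 * Complex.I) * Complex.exp ((t.im : ℂ) * z.2 * Complex.I) := by
    intro z
    rw [← Complex.exp_add, Complex.inner]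
    congr 1
    simp
    ring
  rw [charFun_apply, complexGaussian, integral_map hm.aemeasurable
    (Measurable.aestronglyMeasurable (by fun_prop))]
  simp_rw [h]
  rw [integral_prod_mul (fun x : ℝ => Complex.exp ((t.re : ℂ) * x * Complex.I))
    (fun x : ℝ => Complex.exp ((t.im : ℂ) * x * Complex.I)), ← charFun_apply_real,
    ← charFun_apply_real, charFun_gaussianReal, charFun_gaussianReal, ← Complex.exp_add,
    ← Complex.ofReal_pow ‖t‖, ← Complex.normSq_eq_norm_sq, Complex.normSq_apply,
    Real.coe_toNNReal _ (by positivity)]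
  congr 1
  push_cast
  ring

theorem charFun_complexGaussianVector {s : ℝ} (hs : 0 < s) (L : ℕ)
    (t : EuclideanSpace ℂ (Fin L)) :
    charFun (complexGaussianVector L s) t = Complex.exp (-(s / 4) * ‖t‖ ^ 2) := by
  rw [complexGaussianVector, charFun_pi]
  simp_rw [charFun_complexGaussian hs]
  rw [← Complex.exp_sum, ← Complex.ofReal_pow, EuclideanSpace.norm_sq_eq, ← Finset.mul_sum]
  push_cast
  rfl

theorem finrank_real_euclideanSpace_complex (L : ℕ) :
    Module.finrank ℝ (EuclideanSpace ℂ (Fin L)) = 2 * L := by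
  rw [finrank_real_of_complex]
  simp

theorem real_inner_euclideanSpace_complex {L : ℕ} (x y : EuclideanSpace ℂ (Fin L)) :
    inner ℝ x y = (inner ℂ x y).re := by
  simp [PiLp.inner_apply, Complex.inner, mul_comm]

/-- The squared norm of the component of a standard complex Gaussian vector orthogonal to a unit
vector has the law of the squared norm of a standard complex Gaussian vector with one entry
less. -/
theorem map_normSq_sub_inner_complexGaussianVector {s : ℝ} (hs : 0 < s) {n : ℕ}
    {v : EuclideanSpace ℂ (Fin (n + 1))} (hv : ‖v‖ = 1) :
    (complexGaussianVector (n + 1) s).map (fun h => ‖h‖ ^ 2 - ‖inner ℂ v h‖ ^ 2) =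
      (complexGaussianVector n s).map (fun h => ‖h‖ ^ 2) := by
  have : Fact (Module.finrank ℂ (EuclideanSpace ℂ (Fin (n + 1))) = n + 1) := ⟨by simp⟩
  have hv0 : v ≠ 0 := norm_ne_zero_iff.1 (by simp [hv])
  set W : Submodule ℂ (EuclideanSpace ℂ (Fin (n + 1))) := (Submodule.span ℂ {v})ᗮ
  let R := (OrthonormalBasis.fromOrthogonalSpanSingleton (𝕜 := ℂ) n hv0).repr
  let T : EuclideanSpace ℂ (Fin (n + 1)) → EuclideanSpace ℂ (Fin n) :=
    fun h => R (W.orthogonalProjectionOnto h)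
  have hT : Measurable T :=
    (R.continuous.comp W.orthogonalProjectionOnto.continuous).measurable
  have hnorm : ∀ h, ‖T h‖ ^ 2 = ‖h‖ ^ 2 - ‖inner ℂ v h‖ ^ 2 := by
    intro h
    have h1 := Submodule.norm_sq_eq_add_norm_sq_projection h (Submodule.span ℂ {v})
    have h2 : ‖(Submodule.span ℂ {v}).orthogonalProjectionOnto h‖ = ‖inner ℂ v h‖ := by
      rw [← Submodule.norm_coe, ← Submodule.starProjection_apply,
        Submodule.starProjection_unit_singleton ℂ hv, norm_smul, hv, mul_one]
    rw [h2] at h1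
    simp only [T, LinearIsometryEquiv.norm_map]
    linarith
  have hmap : (complexGaussianVector (n + 1) s).map T = complexGaussianVector n s := by
    have := Measure.isProbabilityMeasure_map (μ := complexGaussianVector (n + 1) s)
      hT.aemeasurable
    refine Measure.ext_of_charFun ?_
    ext t
    -- The adjoint of `T` is an isometric embedding, so the characteristic function of `T h` at `t`
    -- is that of `h` at a vector of the same norm, and the Gaussian one depends on the norm alone.
    have hin : ∀ h, inner ℝ (T h) t = inner ℝ h (R.symm t : EuclideanSpace ℂ (Fin (n + 1))) := by
      intro h
      rw [real_inner_euclideanSpace_complex, real_inner_euclideanSpace_complex]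
      congr 1
      have : inner ℂ (T h) t = inner ℂ (W.orthogonalProjectionOnto h) (R.symm t) := by
        rw [← R.inner_map_map, R.apply_symm_apply]
      rw [this]
      exact Submodule.inner_orthogonalProjectionOnto_eq_of_mem_right (R.symm t) h
    rw [charFun_apply, integral_map hT.aemeasurable
      (Measurable.aestronglyMeasurable (by fun_prop))]
    simp_rw [hin]
    rw [← charFun_apply, charFun_complexGaussianVector hs, charFun_complexGaussianVector hs]
    congr 4
    rw [Submodule.norm_coe, LinearIsometryEquiv.norm_map]
  simp_rw [← hnorm]
  rw [← hmap, Measure.map_map (by fun_prop) hT]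
  rfl

end ComplexGaussian

/-! ### Optimal value of orthogonal beamforming. -/

section Beamforming

/-- The optimal value of orthogonal cognitive beamforming. -/
theorem IsOCB.norm_inner_sq {L : ℕ} {v s f : EuclideanSpace ℂ (Fin L)} {P : ℝ}
    (hf : IsOCB v s P f) (hv : ‖v‖ = 1) (hP : 0 ≤ P) :
    ‖inner ℂ f s‖ ^ 2 = P * (‖s‖ ^ 2 - ‖inner ℂ v s‖ ^ 2) := by
  obtain ⟨⟨hf1, hf2⟩, hmax⟩ := hf
  set w := s - inner ℂ v s • v with hw
  have hvw : inner ℂ v w = 0 := by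
    rw [hw, inner_sub_right, inner_smul_right, inner_self_eq_norm_sq_to_K, hv]
    simp
  have hwv : inner ℂ w v = 0 := inner_eq_zero_symm.1 hvw
  have hsw : s = w + inner ℂ v s • v := by simp [hw]
  have hnw : ‖w‖ ^ 2 = ‖s‖ ^ 2 - ‖inner ℂ v s‖ ^ 2 := by
    have h := norm_add_sq_eq_norm_sq_add_norm_sq_of_inner_eq_zero w (inner ℂ v s • v)
      (by rw [inner_smul_right, hwv, mul_zero])
    rw [← hsw, norm_smul, hv, mul_one] at h
    nlinarith
  rw [← hnw]
  apply le_antisymm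
  · have h1 : inner ℂ f s = inner ℂ f w := by
      conv_lhs => rw [hsw]
      rw [inner_add_right, inner_smul_right, hf1, mul_zero, add_zero]
    rw [h1]
    calc ‖inner ℂ f w‖ ^ 2 ≤ (‖f‖ * ‖w‖) ^ 2 := by gcongr; exact norm_inner_le_norm f w
      _ = ‖f‖ ^ 2 * ‖w‖ ^ 2 := by ring
      _ ≤ P * ‖w‖ ^ 2 := by gcongr
  -- The maximum is attained along `w` at full power. If `w = 0`, then `r = 0` by the convention for
  -- division and both sides vanish.
  · set r : ℝ := √P / ‖w‖ with hr
    have hmem : (r : ℂ) • w ∈ ocbFeasible v P := by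
      refine ⟨by rw [inner_smul_left, hwv, mul_zero], ?_⟩
      rw [norm_smul, Complex.norm_real, mul_pow, hr, Real.norm_eq_abs, sq_abs, div_pow,
        Real.sq_sqrt hP]
      by_cases h0 : ‖w‖ = 0
      · simpa [h0] using hP
      · exact (div_mul_cancel₀ P (pow_ne_zero 2 h0)).le
    have h2 := hmax hmem
    have h3 : inner ℂ w s = (‖w‖ ^ 2 : ℝ) := by
      rw [hsw, inner_add_right, inner_smul_right, hwv, mul_zero, add_zero,
        inner_self_eq_norm_sq_to_K]
      simp
    simp only [Set.mem_ofPred_eq, inner_smul_left, norm_mul, h3, Complex.norm_real,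
      Complex.conj_ofReal] at h2
    refine le_trans (le_of_eq ?_) h2
    rw [mul_pow, Real.norm_eq_abs, Real.norm_eq_abs, sq_abs, sq_abs, hr, div_pow, Real.sq_sqrt hP]
    by_cases h0 : ‖w‖ = 0
    · simp [h0]
    · field_simp

/-- The factor `‖h‖²` undoes the normalization of the direction; for `h = 0` both sides are zero. -/
theorem IsOCB.normSq_mul_norm_inner_sq {L : ℕ} {v h f : EuclideanSpace ℂ (Fin L)} {P : ℝ}
    (hf : IsOCB v (channelShape h) P f) (hv : ‖v‖ = 1) (hP : 0 ≤ P) :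
    ‖h‖ ^ 2 * ‖inner ℂ f (channelShape h)‖ ^ 2 = P * (‖h‖ ^ 2 - ‖inner ℂ v h‖ ^ 2) := by
  rw [hf.norm_inner_sq hv hP]
  by_cases h0 : ‖h‖ = 0
  · simp [norm_eq_zero.1 h0]
  · simp only [channelShape, inner_smul_right, norm_smul, norm_mul, Complex.norm_real,
      Real.norm_eq_abs, mul_pow, sq_abs]
    field_simp

theorem one_sub_norm_inner_channelShape_nonneg {L : ℕ} {v : EuclideanSpace ℂ (Fin L)}
    (hv : ‖v‖ = 1) (h : EuclideanSpace ℂ (Fin L)) : 0 ≤ 1 - ‖inner ℂ v (channelShape h)‖ ^ 2 := by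
  have h1 : ‖channelShape h‖ ≤ 1 := by
    rw [channelShape, norm_smul, Complex.norm_real, norm_inv, norm_norm]
    exact inv_mul_le_one
  have h2 := norm_inner_le_norm (𝕜 := ℂ) v (channelShape h)
  rw [hv, one_mul] at h2
  have := pow_le_one₀ (n := 2) (norm_nonneg _) (h2.trans h1)
  linarith

end Beamforming

/-! ### Gamma integrals for the channel powers. -/

section GammaLaw

theorem integral_map_normSq_complexGaussianVector {n : ℕ} (hn : 0 < n) {g : ℝ → ℝ}
    (hg : Measurable g) :
    ∫ y, g y ∂(complexGaussianVector n 1).map (fun h => ‖h‖ ^ 2) =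
      (Real.Gamma n)⁻¹ * ∫ t in Set.Ioi (0 : ℝ), t ^ ((n : ℝ) - 1) * Real.exp (-t) * g t := by
  rw [integral_map (Measurable.aemeasurable (by fun_prop)) hg.aestronglyMeasurable,
    ← integral_normSq_of_charFun one_pos (charFun_complexGaussianVector one_pos n) hn
      (finrank_real_euclideanSpace_complex n)]
  simp

theorem setIntegral_mul_indicator {A s : Set ℝ} (hs : MeasurableSet s) (hsA : s ⊆ A)
    (f g : ℝ → ℝ) : ∫ t in A, f t * s.indicator g t = ∫ t in s, f t * g t := by
  have h : ∀ t, f t * s.indicator g t = s.indicator (fun t => f t * g t) t := fun t => by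
    by_cases ht : t ∈ s <;> simp [ht]
  simp_rw [h]
  rw [setIntegral_indicator hs, Set.inter_eq_self_of_subset_right hsA]

theorem measureReal_Ioi_map_normSq_complexGaussianVector {n : ℕ} (hn : 0 < n) {a : ℝ}
    (ha : 0 < a) :
    ((complexGaussianVector n 1).map (fun h => ‖h‖ ^ 2)).real (Set.Ioi a) =
      upperGamma n a / Real.Gamma n := by
  rw [← integral_indicator_one measurableSet_Ioi,
    integral_map_normSq_complexGaussianVector hn (measurable_one.indicator measurableSet_Ioi),
    setIntegral_mul_indicator measurableSet_Ioi (Set.Ioi_subset_Ioi ha.le), div_eq_inv_mul,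
    upperGamma]
  simp

/-- The factor `1/t` lowers the exponent of the Gamma density by one. For `n = 1` (that is `L = 2`)
this gives `Γ(0, a)`, which is finite because `a > 0`. -/
theorem integral_indicator_inv_map_normSq_complexGaussianVector {n : ℕ} (hn : 0 < n) {a : ℝ}
    (ha : 0 < a) :
    ∫ y, (Set.Ioi a).indicator (fun y => y⁻¹) y
        ∂(complexGaussianVector n 1).map (fun h => ‖h‖ ^ 2) =
      upperGamma ((n : ℝ) - 1) a / Real.Gamma n := by
  rw [integral_map_normSq_complexGaussianVector hn (measurable_inv.indicator measurableSet_Ioi),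
    setIntegral_mul_indicator measurableSet_Ioi (Set.Ioi_subset_Ioi ha.le), div_eq_inv_mul,
    upperGamma]
  congr 1
  refine setIntegral_congr_fun measurableSet_Ioi fun t ht => ?_
  have ht : 0 < t := ha.trans ht
  rw [Real.rpow_sub_one ht.ne' ((n : ℝ) - 1)]
  ring

/-- The case `n = 1` of the Gamma law: the power of one standard entry is exponential with rate 1.
-/
theorem measureReal_Icc_map_normSq_complexGaussian {b c : ℝ} (hb : 0 < b) (hbc : b ≤ c) :
    ((complexGaussian 1).map (fun h => ‖h‖ ^ 2)).real (Set.Icc b c) =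
      Real.exp (-b) - Real.exp (-c) := by
  have hm : Measurable ((Set.Icc b c).indicator (1 : ℝ → ℝ)) :=
    measurable_one.indicator measurableSet_Icc
  have hsub : Set.Icc b c ⊆ Set.Ioi 0 := fun t ht => Set.mem_Ioi.2 (hb.trans_le ht.1)
  have h := integral_normSq_of_charFun (n := 1) one_pos (charFun_complexGaussian one_pos) one_pos
    (by simp) ((Set.Icc b c).indicator (1 : ℝ → ℝ))
  simp only [div_one] at h
  rw [← integral_indicator_one measurableSet_Icc,
    integral_map (Measurable.aemeasurable (by fun_prop)) hm.aestronglyMeasurable, h,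
    setIntegral_mul_indicator measurableSet_Icc hsub, integral_Icc_eq_integral_Ioc,
    ← intervalIntegral.integral_of_le hbc]
  simp

end GammaLaw

/-! ### Independence from a constant conditional law. -/

/-- If the conditional law of `g (X, W)` given `W` does not depend on `W`, then `g (X, W)` is
independent of `W`. -/
theorem hasLaw_prodMk_of_map_eq {Ω α β γ : Type*} [MeasurableSpace Ω] [MeasurableSpace α]
    [MeasurableSpace β] [MeasurableSpace γ] {μ : Measure Ω} [IsProbabilityMeasure μ]
    {κ : Measure α} {ν : Measure β} {ρ : Measure γ} [IsProbabilityMeasure κ]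
    [IsProbabilityMeasure ν] [IsProbabilityMeasure ρ] {X : Ω → α} {W : Ω → β}
    (hX : HasLaw X κ μ) (hW : HasLaw W ν μ) (hXW : IndepFun X W μ) {g : α × β → γ}
    (hg : Measurable g) (hρ : ∀ᵐ w ∂ν, κ.map (fun x => g (x, w)) = ρ) :
    HasLaw (fun ω => (g (X ω, W ω), W ω)) (ρ.prod ν) μ := by
  have hXW' : HasLaw (fun ω => (X ω, W ω)) (κ.prod ν) μ :=
    (indepFun_iff_hasLaw_prodMk_prod hX hW).1 hXW
  have hm : Measurable (fun p : α × β => (g p, p.2)) := hg.prodMk measurable_snd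
  have hmap : HasLaw (fun p : α × β => (g p, p.2)) (ρ.prod ν) (κ.prod ν) := by
    refine ⟨hm.aemeasurable, (Measure.prod_eq fun s t hs ht => ?_).symm⟩
    rw [Measure.map_apply hm (hs.prod ht), Measure.prod_apply_symm (hm (hs.prod ht))]
    calc ∫⁻ w, κ ((fun x => (x, w)) ⁻¹' ((fun p : α × β => (g p, p.2)) ⁻¹' s ×ˢ t)) ∂ν
        = ∫⁻ w, t.indicator (fun _ => ρ s) w ∂ν := by
          refine lintegral_congr_ae ?_
          filter_upwards [hρ] with w hw
          by_cases hwt : w ∈ t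
          · have hgw : Measurable (fun x => g (x, w)) := hg.comp measurable_prodMk_right
            rw [Set.indicator_of_mem hwt, ← hw, Measure.map_apply hgw hs]
            congr 1
            ext x
            simp [hwt]
          · rw [Set.indicator_of_notMem hwt]
            convert measure_empty (μ := κ)
            ext x
            simp [hwt]
      _ = ρ s * ν t := lintegral_indicator_const ht _
  exact hmap.comp hXW'

/-! ### First-order expansion of the outage probability. -/

section Asymptotics

theorem abs_one_sub_exp_neg_sub_self_le {x : ℝ} (hx : 0 ≤ x) :
    |1 - Real.exp (-x) - x| ≤ x ^ 2 / 2 := by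
  have h1 : 1 - x ≤ Real.exp (-x) := by linarith [Real.add_one_le_exp (-x)]
  have h2 : Real.exp (-x) ≤ 1 - x + x ^ 2 / 2 := by
    have h3 := Real.quadratic_le_exp_of_nonneg hx
    have h4 : Real.exp (-x) * Real.exp x = 1 := by rw [← Real.exp_add]; simp
    -- The product equals `1 + x⁴/4`.
    have h5 : 1 ≤ (1 - x + x ^ 2 / 2) * (1 + x + x ^ 2 / 2) := by nlinarith [sq_nonneg (x ^ 2)]
    have h6 : 0 < 1 - x + x ^ 2 / 2 := by nlinarith [sq_nonneg (x - 1)]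
    have h7 := Real.exp_pos x
    have h8 : (1 - x + x ^ 2 / 2) * (1 + x + x ^ 2 / 2) ≤ (1 - x + x ^ 2 / 2) * Real.exp x := by
      gcongr
    refine le_of_mul_le_mul_right (a := Real.exp x) ?_ h7
    linarith
  rw [abs_le]
  constructor <;> linarith

theorem measurableSet_outage {β : Type*} [MeasurableSpace β] (a b : ℝ) {z : β → ℝ}
    (hz : Measurable z) :
    MeasurableSet {p : ℝ × ℝ × β | p.2.1 ≤ a ∨ (b ≤ p.1 ∧ (p.1 - b) * p.2.1 ≤ b * z p.2.2)} := by
  have h1 : MeasurableSet {p : ℝ × ℝ × β | p.2.1 ≤ a} :=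
    measurableSet_le (by fun_prop) (by fun_prop)
  have h2 : MeasurableSet {p : ℝ × ℝ × β | b ≤ p.1} :=
    measurableSet_le (by fun_prop) (by fun_prop)
  have h3 : MeasurableSet {p : ℝ × ℝ × β | (p.1 - b) * p.2.1 ≤ b * z p.2.2} :=
    measurableSet_le (by fun_prop) (by fun_prop)
  exact h1.union (h2.inter h3)

/-- First-order expansion of the probability that `Y ≤ a`, or that the exponential variable `G`
lies in `[b, b (1 + Z / Y)]`, for independent `G`, `Y`, `Z`. -/
theorem abs_measureReal_outage_sub_le {β : Type*} [MeasurableSpace β] (ρ : Measure ℝ)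
    [IsProbabilityMeasure ρ] (ν : Measure β) [IsProbabilityMeasure ν] {a b : ℝ} (ha : 0 < a)
    (hb : 0 < b) {z : β → ℝ} (hz : Measurable z) (hz0 : ∀ᵐ x ∂ν, 0 ≤ z x)
    (hz1 : Integrable z ν) (hz2 : Integrable (fun x => z x ^ 2) ν) :
    |(((complexGaussian 1).map (fun h => ‖h‖ ^ 2)).prod (ρ.prod ν)).real
        {p | p.2.1 ≤ a ∨ (b ≤ p.1 ∧ (p.1 - b) * p.2.1 ≤ b * z p.2.2)} -
      (ρ.real (Set.Iic a) + Real.exp (-b) * b *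
        ((∫ y, (Set.Ioi a).indicator (fun y => y⁻¹) y ∂ρ) * ∫ x, z x ∂ν))| ≤
      b ^ 2 / (2 * a ^ 2) * ∫ x, z x ^ 2 ∂ν := by
  set τ := (complexGaussian 1).map (fun h => ‖h‖ ^ 2) with hτ
  have : IsProbabilityMeasure τ := Measure.isProbabilityMeasure_map (by fun_prop)
  set S : Set (ℝ × ℝ × β) :=
    {p | p.2.1 ≤ a ∨ (b ≤ p.1 ∧ (p.1 - b) * p.2.1 ≤ b * z p.2.2)} with hS
  have hSm : MeasurableSet S := measurableSet_outage a b hz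
  -- `F` is the conditional probability of outage given the last two coordinates. It is compared
  -- pointwise with the integrand of the main term, and the difference is then integrated.
  set F : ℝ × β → ℝ := fun p => τ.real ((fun g => (g, p)) ⁻¹' S) with hF
  have hFm : Measurable F := (measurable_measure_prodMk_right hSm).ennreal_toReal
  have hSF : (τ.prod (ρ.prod ν)).real S = ∫ p, F p ∂ρ.prod ν := by
    rw [measureReal_def, Measure.prod_apply_symm hSm, ← integral_toReal]
    · rfl
    · exact (measurable_measure_prodMk_right hSm).aemeasurable
    · exact Filter.Eventually.of_forall fun p => measure_lt_top _ _
  have hFint : Integrable F (ρ.prod ν) := by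
    refine Integrable.of_bound hFm.aestronglyMeasurable 1 (Filter.Eventually.of_forall fun p => ?_)
    rw [Real.norm_of_nonneg measureReal_nonneg]
    exact measureReal_le_one
  set r : ℝ → ℝ := (Set.Ioi a).indicator (fun y => y⁻¹) with hr
  have hrm : Measurable r := measurable_inv.indicator measurableSet_Ioi
  have hrint : Integrable r ρ := by
    refine Integrable.of_bound hrm.aestronglyMeasurable a⁻¹ (Filter.Eventually.of_forall fun y => ?_)
    by_cases hy : y ∈ Set.Ioi a
    · have hy' : a < y := hy
      have := ha.trans hy'
      rw [hr, Set.indicator_of_mem hy, Real.norm_of_nonneg (by positivity)]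
      gcongr
    · simp [hr, hy, ha.le]
  set o : ℝ → ℝ := (Set.Iic a).indicator 1 with ho
  have hoint : Integrable o ρ := (integrable_const (1 : ℝ)).indicator measurableSet_Iic
  have hG1 : Integrable (fun p : ℝ × β => o p.1) (ρ.prod ν) := hoint.comp_fst ν
  have hG2 : Integrable (fun p : ℝ × β => r p.1 * z p.2) (ρ.prod ν) := hrint.mul_prod hz1
  have hG : ρ.real (Set.Iic a) + Real.exp (-b) * b * ((∫ y, r y ∂ρ) * ∫ x, z x ∂ν) =
      ∫ p, (o p.1 + Real.exp (-b) * b * (r p.1 * z p.2)) ∂ρ.prod ν := by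
    rw [integral_add hG1 (hG2.const_mul _), integral_const_mul, integral_prod_mul, integral_fun_fst,
      ho, integral_indicator_one measurableSet_Iic]
    simp
  have hz2' : Integrable (fun p : ℝ × β => z p.2 ^ 2) (ρ.prod ν) := hz2.comp_snd ρ
  have hR : b ^ 2 / (2 * a ^ 2) * ∫ x, z x ^ 2 ∂ν =
      ∫ p, b ^ 2 / (2 * a ^ 2) * z p.2 ^ 2 ∂ρ.prod ν := by
    rw [integral_const_mul, integral_fun_snd (fun x => z x ^ 2)]
    simp
  have hGint : Integrable (fun p : ℝ × β => o p.1 + Real.exp (-b) * b * (r p.1 * z p.2))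
      (ρ.prod ν) := hG1.add (hG2.const_mul _)
  rw [hSF, hG, hR, ← integral_sub hFint hGint, ← Real.norm_eq_abs]
  refine norm_integral_le_of_norm_le (hz2'.const_mul _) ?_
  have hz0' : ∀ᵐ p ∂ρ.prod ν, 0 ≤ z p.2 :=
    Measure.quasiMeasurePreserving_snd.ae hz0
  filter_upwards [hz0'] with p hp
  rw [Real.norm_eq_abs]
  obtain ⟨y, x⟩ := p
  simp only at hp ⊢
  by_cases hy : y ≤ a
  · have h1 : F (y, x) = 1 := by
      have : (fun g : ℝ => (g, (y, x))) ⁻¹' S = Set.univ := by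
        ext g
        simp [hS, hy]
      simp [hF, this]
    have h2 : o y = 1 := by simp [ho, hy]
    have h3 : r y = 0 := by simp [hr, hy]
    rw [h1, h2, h3]
    simp only [zero_mul, mul_zero, add_zero, sub_self, abs_zero]
    positivity
  · have hy' : a < y := not_le.1 hy
    have hy0 : 0 < y := ha.trans hy'
    have hzy : 0 ≤ b * z x / y := by positivity
    have h1 : F (y, x) = Real.exp (-b) * (1 - Real.exp (-(b * z x / y))) := by
      -- For `y > a` only the exponential coordinate can cause outage, by falling in this interval.
      have : (fun g : ℝ => (g, (y, x))) ⁻¹' S = Set.Icc b (b + b * z x / y) := by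
        ext g
        simp only [hS, Set.mem_preimage, Set.mem_ofPred_eq, hy, false_or, Set.mem_Icc]
        rw [← le_div_iff₀ hy0, sub_le_iff_le_add']
      rw [hF]
      simp only [this]
      rw [measureReal_Icc_map_normSq_complexGaussian hb (by linarith), neg_add, Real.exp_add]
      ring
    have h2 : o y = 0 := by simp [ho, hy']
    have h3 : r y = y⁻¹ := by simp [hr, hy']
    rw [h1, h2, h3]
    have h4 : Real.exp (-b) * (1 - Real.exp (-(b * z x / y))) -
        (0 + Real.exp (-b) * b * (y⁻¹ * z x)) =
        Real.exp (-b) * (1 - Real.exp (-(b * z x / y)) - b * z x / y) := by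
      field_simp
      ring
    rw [h4, abs_mul, abs_of_pos (Real.exp_pos _)]
    calc Real.exp (-b) * |1 - Real.exp (-(b * z x / y)) - b * z x / y|
        ≤ 1 * ((b * z x / y) ^ 2 / 2) := by
          gcongr
          · exact Real.exp_le_one_iff.2 (by linarith)
          · exact abs_one_sub_exp_neg_sub_self_le hzy
      _ = b ^ 2 / (2 * y ^ 2) * z x ^ 2 := by field_simp
      _ ≤ b ^ 2 / (2 * a ^ 2) * z x ^ 2 := by gcongr

end Asymptotics

/-! ### Consequences of the distribution function of the quantization error. -/

section QuantizationError

variable {Ω : Type*} [MeasurableSpace Ω] {μ : Measure Ω} [IsProbabilityMeasure μ] {X : Ω → ℝ}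
  {K δ : ℝ} {m : ℕ}

/-- Evaluate at `t = 0`, where `0 ^ m = 0`. Positivity matters because `ipc` divides by the error:
with `x / 0 = 0`, a zero error and a nonnegative margin would give power `0` instead of `Pmax`. -/
theorem ae_pos_of_measureReal_le_eq (hδ : 0 ≤ δ) (hm : m ≠ 0)
    (h : ∀ t, 0 ≤ t → t ≤ δ → μ.real {ω | X ω ≤ t} = K * t ^ m) : ∀ᵐ ω ∂μ, 0 < X ω := by
  have h0 := h 0 le_rfl hδ
  rw [zero_pow hm, mul_zero, measureReal_eq_zero_iff] at h0
  simpa [ae_iff] using h0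

theorem ae_le_of_measureReal_le_eq (hX : AEMeasurable X μ) (hδ : 0 ≤ δ) (hK : K * δ ^ m = 1)
    (h : ∀ t, 0 ≤ t → t ≤ δ → μ.real {ω | X ω ≤ t} = K * t ^ m) : ∀ᵐ ω ∂μ, X ω ≤ δ := by
  have h1 := h δ hδ le_rfl
  rw [hK] at h1
  refine (mem_ae_iff_prob_eq_one₀ (nullMeasurableSet_le hX aemeasurable_const)).2 ?_
  rw [← ENNReal.toReal_eq_one_iff]
  exact h1

/-- Layer cake: the mean is `∫₀^δ (1 - K t^m) dt = δ - K δ^(m+1)/(m+1)`, and `K δ^m = 1`. -/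
theorem integral_of_measureReal_le_eq (hX : AEMeasurable X μ) (hδ : 0 ≤ δ) (hm : m ≠ 0)
    (hK : K * δ ^ m = 1) (h : ∀ t, 0 ≤ t → t ≤ δ → μ.real {ω | X ω ≤ t} = K * t ^ m) :
    ∫ ω, X ω ∂μ = δ * (m / (m + 1)) := by
  have hpos := ae_pos_of_measureReal_le_eq hδ hm h
  have hle := ae_le_of_measureReal_le_eq hX hδ hK h
  have hint : Integrable X μ := by
    refine Integrable.of_bound hX.aestronglyMeasurable δ ?_
    filter_upwards [hpos, hle] with ω h1 h2
    rwa [Real.norm_of_nonneg h1.le]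
  rw [hint.integral_eq_integral_meas_lt (hpos.mono fun _ h => h.le)]
  have hcompl : ∀ t, μ.real {ω | t < X ω} = 1 - μ.real {ω | X ω ≤ t} := by
    intro t
    rw [← probReal_compl_eq_one_sub₀ (nullMeasurableSet_le hX aemeasurable_const)]
    congr 1
    ext ω
    simp
  have h1 : ∫ t in Set.Ioi (0 : ℝ), μ.real {ω | t < X ω} =
      ∫ t in Set.Ioi (0 : ℝ), (Set.Ioc 0 δ).indicator (fun t => 1 - K * t ^ m) t := by
    refine setIntegral_congr_fun measurableSet_Ioi fun t ht => ?_
    have ht : 0 < t := ht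
    change μ.real {ω | t < X ω} = _
    rw [hcompl]
    by_cases htδ : t ≤ δ
    · rw [Set.indicator_of_mem (Set.mem_Ioc.2 ⟨ht, htδ⟩), h t ht.le htδ]
    · rw [Set.indicator_of_notMem (fun hh => htδ hh.2), sub_eq_zero]
      have := measureReal_mono (μ := μ)
        (show {ω | X ω ≤ δ} ⊆ {ω | X ω ≤ t} from fun ω hω => le_trans hω (not_le.1 htδ).le)
      rw [h δ hδ le_rfl, hK] at this
      exact le_antisymm this measureReal_le_one
  rw [h1, setIntegral_indicator measurableSet_Ioc,
    Set.inter_eq_self_of_subset_right Set.Ioc_subset_Ioi_self,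
    ← intervalIntegral.integral_of_le hδ, intervalIntegral.integral_sub (by simp) (by
      exact (Continuous.intervalIntegrable (by fun_prop) _ _)),
    intervalIntegral.integral_const_mul, integral_pow]
  simp only [intervalIntegral.integral_const, smul_eq_mul, sub_zero, mul_one]
  rw [zero_pow (by omega), sub_zero, pow_succ, mul_div_assoc', ← mul_assoc, hK]
  field_simp
  ring

end QuantizationError

/-! ### The outage event in terms of channel gains. -/

theorem measurable_channelShape {L : ℕ} :
    Measurable (channelShape : EuclideanSpace ℂ (Fin L) → EuclideanSpace ℂ (Fin L)) := by
  unfold channelShape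
  fun_prop

theorem channelShape_eq_real_smul {L : ℕ} (h : EuclideanSpace ℂ (Fin L)) :
    channelShape h = ‖h‖⁻¹ • h := by
  rw [channelShape, Complex.coe_smul]

namespace CRParams

variable (p : CRParams)

theorem gammaP_pos : 0 < p.gammaP := div_pos p.Pp_pos p.noise_pos

theorem gammaMax_pos : 0 < p.gammaMax := div_pos p.Pmax_pos p.noise_pos

theorem powerLimit_nonneg {g gx e : ℝ} (hgx : 0 ≤ gx) (he : 0 ≤ e) :
    0 ≤ p.powerLimit g gx e := by
  have := p.lam_pos
  unfold powerLimit
  split_ifs with h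
  · rw [ipc, if_pos h.1]
    exact div_nonneg h.1 (by positivity)
  · exact p.Pmax_pos.le

/-- For a nonnegative margin the allowed power is the minimum of `Pmax` and `margin / (λ g_x e)`. As
`y ≥ 0`, the minimum times `y` stays below a threshold exactly when one of the two products does.
For a negative margin only `Pmax` remains, which is the condition `b ≤ g` in the second alternative.
-/
theorem outage_iff {g gx e y : ℝ} (hgx : 0 < gx) (he : 0 < e) (hy : 0 ≤ y) :
    p.powerLimit g gx e * y ≤ p.thetaS * p.noise ↔
      y ≤ p.thetaS / p.gammaMax ∨ (p.thetaP / p.gammaP ≤ g ∧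
        (g - p.thetaP / p.gammaP) * y ≤ p.thetaP / p.gammaP * (p.thetaS * (p.lam * gx * e))) := by
  have hlam := p.lam_pos
  have hσ := p.noise_pos
  have hPm := p.Pmax_pos
  have hθs := p.thetaS_pos
  set b := p.thetaP / p.gammaP with hb
  have hb0 : 0 < b := div_pos p.thetaP_pos p.gammaP_pos
  set d := p.lam * gx * e with hd
  have hd0 : 0 < d := by positivity
  have hm : p.margin g = p.noise * (g - b) / b := by
    have := p.thetaP_pos
    have := p.gammaP_pos
    rw [margin, hb]
    field_simp
  have hm0 : 0 ≤ p.margin g ↔ b ≤ g := by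
    rw [hm, ← sub_nonneg (a := g), le_div_iff₀ hb0, zero_mul, mul_nonneg_iff_of_pos_left hσ]
  have hmy : (g - b) * y ≤ b * (p.thetaS * d) ↔ p.margin g * y ≤ p.noise * p.thetaS * d := by
    rw [hm, show p.noise * (g - b) / b * y = p.noise * ((g - b) * y / b) by ring,
      mul_assoc p.noise, mul_le_mul_iff_right₀ hσ, div_le_iff₀' hb0]
  have ha : y ≤ p.thetaS / p.gammaMax ↔ p.Pmax * y ≤ p.thetaS * p.noise := by
    rw [gammaMax, div_div_eq_mul_div, le_div_iff₀ hPm, mul_comm y]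
  rw [ha, hmy, ← hm0, powerLimit]
  by_cases h0 : 0 ≤ p.margin g
  · have hi : p.ipc g gx e = p.margin g / d := by rw [ipc, if_pos h0]
    simp only [h0, true_and, hi]
    split_ifs with h1
    · rw [div_lt_iff₀ hd0] at h1
      rw [div_mul_eq_mul_div, div_le_iff₀ hd0]
      constructor
      · intro h
        right
        linarith
      · rintro (h | h)
        · calc p.margin g * y ≤ p.Pmax * d * y := by gcongr
            _ = p.Pmax * y * d := by ring
            _ ≤ _ := by gcongr
        · linarith
    · rw [div_lt_iff₀ hd0] at h1
      refine ⟨Or.inl, ?_⟩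
      rintro (h | h)
      · exact h
      · have h2 : p.Pmax * d * y ≤ p.margin g * y := by
          gcongr
          exact not_lt.1 h1
        refine le_of_mul_le_mul_right (a := d) ?_ hd0
        linarith
  · simp [h0]

end CRParams

/-! ### Laws of the random gains and the outage probability of the link. -/

namespace OCBLink

variable {p : CRParams} {Ω : Type u} [MeasurableSpace Ω] {μ : Measure Ω}
  {V : Type v} [MeasurableSpace V]

theorem measurable_direction (N : OCBLink p μ V) :
    Measurable (fun x : EuclideanSpace ℂ (Fin p.L) × V => N.Q (channelShape x.1) x.2) :=
  N.measurable_Q.comp ((measurable_channelShape.comp measurable_fst).prodMk measurable_snd)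

/-- The quantization error as a function of the channel and of the randomness of the quantizer. -/
noncomputable def errorOf (N : OCBLink p μ V) (x : EuclideanSpace ℂ (Fin p.L) × V) : ℝ :=
  1 - ‖inner ℂ (N.Q (channelShape x.1) x.2) (channelShape x.1)‖ ^ 2

theorem measurable_errorOf (N : OCBLink p μ V) : Measurable N.errorOf := by
  have h1 := N.measurable_direction
  have h2 : Measurable (fun x : EuclideanSpace ℂ (Fin p.L) × V => channelShape x.1) :=
    measurable_channelShape.comp measurable_fst
  exact ((h1.inner h2).norm.pow_const 2).const_sub 1

theorem ae_quantError_nonneg (N : OCBLink p μ V) : ∀ᵐ ω ∂μ, 0 ≤ N.quantError ω := by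
  filter_upwards [N.norm_Q] with ω h
  exact one_sub_norm_inner_channelShape_nonneg h _

theorem quantError_le_one (N : OCBLink p μ V) (ω : Ω) : N.quantError ω ≤ 1 :=
  sub_le_self _ (by positivity)

/-- Almost surely `hx ≠ 0` and the error is positive, so no denominator in the power limit vanishes;
moreover `λ g_x = ‖hx‖²`. -/
theorem ae_snrS_le_iff (N : OCBLink p μ V) (hpos : ∀ᵐ ω ∂μ, 0 < N.quantError ω) :
    ∀ᵐ ω ∂μ, N.snrS ω ≤ p.thetaS ↔
      (‖N.hs ω‖ ^ 2 - ‖inner ℂ (N.Q (channelShape (N.hx ω)) (N.U ω)) (N.hs ω)‖ ^ 2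
          ≤ p.thetaS / p.gammaMax) ∨
        (p.thetaP / p.gammaP ≤ ‖N.hp ω‖ ^ 2 ∧ (‖N.hp ω‖ ^ 2 - p.thetaP / p.gammaP) *
          (‖N.hs ω‖ ^ 2 - ‖inner ℂ (N.Q (channelShape (N.hx ω)) (N.U ω)) (N.hs ω)‖ ^ 2) ≤
            p.thetaP / p.gammaP * (p.thetaS * (‖N.hx ω‖ ^ 2 * N.quantError ω))) := by
  have hL : 0 < p.L := by have := p.two_le_L; omega
  have : Nontrivial (EuclideanSpace ℂ (Fin p.L)) :=
    Module.nontrivial_of_finrank_pos (R := ℂ) (by simpa using hL)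
  have hx0 : ∀ᵐ ω ∂μ, N.hx ω ≠ 0 :=
    (N.law_hx.ae_iff (p := fun x => x ≠ 0)
      (measurableSet_setOfPred.1 (measurableSet_singleton 0).compl)).2
      (ae_ne_zero_of_charFun p.lam_pos (charFun_complexGaussianVector p.lam_pos p.L))
  filter_upwards [hpos, hx0, N.norm_Q, N.isOCB] with ω he hx hv hf
  have hlam := p.lam_pos
  have hn : 0 < ‖N.hx ω‖ := norm_pos_iff.2 hx
  have hgx : 0 < ‖N.hx ω‖ ^ 2 / p.lam := by positivity
  have hy : 0 ≤ ‖N.hs ω‖ ^ 2 -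
      ‖inner ℂ (N.Q (channelShape (N.hx ω)) (N.U ω)) (N.hs ω)‖ ^ 2 := by
    have h := norm_inner_le_norm (𝕜 := ℂ) (N.Q (channelShape (N.hx ω)) (N.U ω)) (N.hs ω)
    rw [hv, one_mul] at h
    exact sub_nonneg.2 (by gcongr)
  have h1 := hf.normSq_mul_norm_inner_sq hv (p.powerLimit_nonneg hgx.le he.le)
  have h2 := p.outage_iff (g := ‖N.hp ω‖ ^ 2) hgx he hy
  rw [mul_div_cancel₀ _ hlam.ne'] at h2
  rw [← h2, snrS, div_mul_eq_mul_div, div_le_iff₀ p.noise_pos, h1]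
  rfl

theorem integrable_norm_hx_pow (N : OCBLink p μ V) (k : ℕ) :
    Integrable (fun ω => ‖N.hx ω‖ ^ k) μ := by
  have h := integrable_norm_pow_of_charFun p.lam_pos
    (charFun_complexGaussianVector p.lam_pos p.L) k
  rw [← N.law_hx.map_eq] at h
  exact h.comp_aemeasurable N.law_hx.aemeasurable

/-- The interference caused by unit transmission power after orthogonal beamforming, in units of
the secondary threshold, as a function of the channel and of the randomness of the quantizer. -/
noncomputable def leakage (N : OCBLink p μ V) (x : EuclideanSpace ℂ (Fin p.L) × V) : ℝ :=
  p.thetaS * (‖x.1‖ ^ 2 * N.errorOf x)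

theorem measurable_leakage (N : OCBLink p μ V) : Measurable N.leakage :=
  (Measurable.mul (by fun_prop) N.measurable_errorOf).const_mul _

section Probability

variable [IsProbabilityMeasure μ]

theorem hasLaw_hx_U (N : OCBLink p μ V) :
    HasLaw (fun ω => (N.hx ω, N.U ω)) ((complexGaussianVector p.L p.lam).prod (μ.map N.U)) μ :=
  (indepFun_iff_hasLaw_prodMk_prod N.law_hx ⟨N.measurable_U.aemeasurable, rfl⟩).1 N.indep_hx

theorem aemeasurable_quantError (N : OCBLink p μ V) : AEMeasurable N.quantError μ := by
  have h : N.quantError = fun ω => N.errorOf (N.hx ω, N.U ω) := rfl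
  rw [h]
  exact N.measurable_errorOf.comp_aemeasurable N.hasLaw_hx_U.aemeasurable

theorem integrable_normSq_hx_mul_quantError (N : OCBLink p μ V) :
    Integrable (fun ω => ‖N.hx ω‖ ^ 2 * N.quantError ω) μ := by
  refine (N.integrable_norm_hx_pow 2).mul_bdd (c := 1)
    N.aemeasurable_quantError.aestronglyMeasurable ?_
  filter_upwards [N.ae_quantError_nonneg] with ω h
  rw [Real.norm_of_nonneg h]
  exact N.quantError_le_one ω

/-- The norm of the channel is independent of its quantization error, so that
`E[‖hx‖² ε] = E[‖hx‖²] E[ε]`. -/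
theorem integral_normSq_hx_mul_quantError (N : OCBLink p μ V) :
    ∫ ω, ‖N.hx ω‖ ^ 2 * N.quantError ω ∂μ = p.L * p.lam * ∫ ω, N.quantError ω ∂μ := by
  have hlaw := N.hasLaw_hx_U
  have := Measure.isProbabilityMeasure_map (μ := μ) N.measurable_U.aemeasurable
  have hL : 0 < p.L := by have := p.two_le_L; omega
  have hm2 : Measurable (fun x : EuclideanSpace ℂ (Fin p.L) × V => ‖x.1‖ ^ 2 * N.errorOf x) :=
    Measurable.mul (by fun_prop) N.measurable_errorOf
  have he : Integrable N.errorOf ((complexGaussianVector p.L p.lam).prod (μ.map N.U)) := by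
    rw [← hlaw.map_eq, integrable_map_measure N.measurable_errorOf.aestronglyMeasurable
      hlaw.aemeasurable]
    refine Integrable.of_bound (C := 1)
      (N.measurable_errorOf.comp_aemeasurable hlaw.aemeasurable).aestronglyMeasurable ?_
    filter_upwards [N.ae_quantError_nonneg] with ω h
    exact (Real.norm_of_nonneg h).trans_le (N.quantError_le_one ω)
  have he2 : Integrable (fun x : EuclideanSpace ℂ (Fin p.L) × V => ‖x.1‖ ^ 2 * N.errorOf x)
      ((complexGaussianVector p.L p.lam).prod (μ.map N.U)) := by
    rw [← hlaw.map_eq, integrable_map_measure hm2.aestronglyMeasurable hlaw.aemeasurable]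
    exact N.integrable_normSq_hx_mul_quantError
  have h1 := hlaw.integral_comp N.measurable_errorOf.aestronglyMeasurable
  have h2 := hlaw.integral_comp hm2.aestronglyMeasurable
  change ∫ ω, N.quantError ω ∂μ = _ at h1
  change ∫ ω, ‖N.hx ω‖ ^ 2 * N.quantError ω ∂μ = _ at h2
  rw [h1, h2, integral_prod_symm _ he, integral_prod_symm _ he2, ← integral_const_mul]
  congr 1
  ext w
  -- With the randomness `w` of the quantizer frozen, the error is a function of the direction of
  -- `hx` alone.
  have h := integral_normSq_mul_direction_eq p.lam_pos
    (charFun_complexGaussianVector p.lam_pos p.L) hL (finrank_real_euclideanSpace_complex p.L)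
    (fun s => 1 - ‖inner ℂ (N.Q s w) s‖ ^ 2)
  simp only [← channelShape_eq_real_smul] at h
  exact h

/-- The power of the component of `hs` orthogonal to the fed back direction has the law of the
squared norm of a vector of `L - 1` standard complex Gaussian variables, and is independent of the
channel `hx` and its quantization. -/
theorem hasLaw_orthogonal_power (N : OCBLink p μ V) :
    HasLaw (fun ω => (‖N.hs ω‖ ^ 2 -
        ‖inner ℂ (N.Q (channelShape (N.hx ω)) (N.U ω)) (N.hs ω)‖ ^ 2, (N.hx ω, N.U ω)))
      (((complexGaussianVector (p.L - 1) 1).map (fun h => ‖h‖ ^ 2)).prod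
        ((complexGaussianVector p.L p.lam).prod (μ.map N.U))) μ := by
  have := Measure.isProbabilityMeasure_map (μ := μ) N.measurable_U.aemeasurable
  have : IsProbabilityMeasure ((complexGaussianVector (p.L - 1) 1).map (fun h => ‖h‖ ^ 2)) :=
    Measure.isProbabilityMeasure_map (by fun_prop)
  have hdir := N.measurable_direction
  have hL : p.L = p.L - 1 + 1 := by have := p.two_le_L; omega
  -- Stated for free `L` and `n` so that `L = n + 1` can be substituted; `p.L` itself cannot be
  -- rewritten in the types.
  have key : ∀ {L n : ℕ} (_ : L = n + 1) (v : EuclideanSpace ℂ (Fin L)), ‖v‖ = 1 →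
      (complexGaussianVector L 1).map (fun h => ‖h‖ ^ 2 - ‖inner ℂ v h‖ ^ 2) =
        (complexGaussianVector n 1).map (fun h => ‖h‖ ^ 2) := by
    rintro L n rfl v hv
    exact map_normSq_sub_inner_complexGaussianVector one_pos hv
  refine hasLaw_prodMk_of_map_eq N.law_hs N.hasLaw_hx_U N.indep_hs
    (g := fun q : EuclideanSpace ℂ (Fin p.L) × (EuclideanSpace ℂ (Fin p.L) × V) =>
      ‖q.1‖ ^ 2 - ‖inner ℂ (N.Q (channelShape q.2.1) q.2.2) q.1‖ ^ 2) ?_ ?_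
  · exact Measurable.sub (by fun_prop)
      (((hdir.comp measurable_snd).inner measurable_fst).norm.pow_const 2)
  · have h : ∀ᵐ x ∂(complexGaussianVector p.L p.lam).prod (μ.map N.U),
        ‖N.Q (channelShape x.1) x.2‖ = 1 := by
      rw [← N.hasLaw_hx_U.map_eq, ae_map_iff N.hasLaw_hx_U.aemeasurable
        (measurableSet_eq_fun hdir.norm measurable_const)]
      exact N.norm_Q
    filter_upwards [h] with x hx
    exact key hL _ hx

/-- Reduces the outage to an event about three independent coordinates: primary gain, orthogonal
power, and the pair `(hx, U)`. -/
theorem outageProb_eq (N : OCBLink p μ V) (hpos : ∀ᵐ ω ∂μ, 0 < N.quantError ω) :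
    N.outageProb =
      (((complexGaussian 1).map (fun h => ‖h‖ ^ 2)).prod
        (((complexGaussianVector (p.L - 1) 1).map (fun h => ‖h‖ ^ 2)).prod
          ((complexGaussianVector p.L p.lam).prod (μ.map N.U)))).real
        {q | q.2.1 ≤ p.thetaS / p.gammaMax ∨ (p.thetaP / p.gammaP ≤ q.1 ∧
          (q.1 - p.thetaP / p.gammaP) * q.2.1 ≤ p.thetaP / p.gammaP * N.leakage q.2.2)} := by
  have := Measure.isProbabilityMeasure_map (μ := μ) N.measurable_U.aemeasurable
  have : IsProbabilityMeasure ((complexGaussianVector (p.L - 1) 1).map (fun h => ‖h‖ ^ 2)) :=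
    Measure.isProbabilityMeasure_map (by fun_prop)
  have : IsProbabilityMeasure ((complexGaussian 1).map (fun h => ‖h‖ ^ 2)) :=
    Measure.isProbabilityMeasure_map (by fun_prop)
  have hG : HasLaw (fun ω => ‖N.hp ω‖ ^ 2) ((complexGaussian 1).map (fun h => ‖h‖ ^ 2)) μ :=
    HasLaw.fun_comp (Y := fun h : ℂ => ‖h‖ ^ 2) ⟨by fun_prop, rfl⟩ N.law_hp
  have hψ : Measurable
      (fun q : EuclideanSpace ℂ (Fin p.L) × EuclideanSpace ℂ (Fin p.L) × V =>
        (‖q.1‖ ^ 2 - ‖inner ℂ (N.Q (channelShape q.2.1) q.2.2) q.1‖ ^ 2, q.2)) :=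
    (Measurable.sub (by fun_prop)
      (((N.measurable_direction.comp measurable_snd).inner measurable_fst).norm.pow_const
        2)).prodMk measurable_snd
  have hind : IndepFun (fun ω => ‖N.hp ω‖ ^ 2) (fun ω => (‖N.hs ω‖ ^ 2 -
      ‖inner ℂ (N.Q (channelShape (N.hx ω)) (N.U ω)) (N.hs ω)‖ ^ 2, (N.hx ω, N.U ω))) μ :=
    N.indep_hp.comp (φ := fun h => ‖h‖ ^ 2) (by fun_prop) hψ
  have hlaw := (indepFun_iff_hasLaw_prodMk_prod hG N.hasLaw_orthogonal_power).1 hind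
  have hS := measurableSet_outage (p.thetaS / p.gammaMax) (p.thetaP / p.gammaP)
    N.measurable_leakage
  rw [← hlaw.measureReal_eq hS, outageProb]
  refine measureReal_congr ?_
  filter_upwards [N.ae_snrS_le_iff hpos] with ω h
  exact propext h

/-- Valid for every almost surely positive error: the main term sees only its mean, the remainder
its second moment weighted by `‖hx‖⁴`. -/
theorem abs_outageProb_sub_le (N : OCBLink p μ V) (hpos : ∀ᵐ ω ∂μ, 0 < N.quantError ω) :
    |N.outageProb - (1 - upperGamma ((p.L : ℝ) - 1) (p.thetaS / p.gammaMax) /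
        Real.Gamma ((p.L : ℝ) - 1) +
      Real.exp (-(p.thetaP / p.gammaP)) * (p.thetaP / p.gammaP) *
        (upperGamma ((p.L : ℝ) - 2) (p.thetaS / p.gammaMax) / Real.Gamma ((p.L : ℝ) - 1) *
          (p.thetaS * (p.L * p.lam * ∫ ω, N.quantError ω ∂μ))))| ≤
      (p.thetaP / p.gammaP) ^ 2 / (2 * (p.thetaS / p.gammaMax) ^ 2) *
        (p.thetaS ^ 2 * ∫ ω, ‖N.hx ω‖ ^ 4 * N.quantError ω ^ 2 ∂μ) := by
  have hL2 := p.two_le_L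
  have hθ := p.thetaS_pos
  have ha0 : 0 < p.thetaS / p.gammaMax := div_pos p.thetaS_pos p.gammaMax_pos
  have hb0 : 0 < p.thetaP / p.gammaP := div_pos p.thetaP_pos p.gammaP_pos
  have hlaw := N.hasLaw_hx_U
  have := Measure.isProbabilityMeasure_map (μ := μ) N.measurable_U.aemeasurable
  have : IsProbabilityMeasure ((complexGaussianVector (p.L - 1) 1).map (fun h => ‖h‖ ^ 2)) :=
    Measure.isProbabilityMeasure_map (by fun_prop)
  have hz := N.measurable_leakage
  have hz0 : ∀ᵐ x ∂(complexGaussianVector p.L p.lam).prod (μ.map N.U), 0 ≤ N.leakage x := by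
    rw [← hlaw.map_eq, ae_map_iff hlaw.aemeasurable (measurableSet_le measurable_const hz)]
    filter_upwards [hpos] with ω h
    exact mul_nonneg hθ.le (mul_nonneg (by positivity) h.le)
  have hz1 : Integrable N.leakage ((complexGaussianVector p.L p.lam).prod (μ.map N.U)) := by
    rw [← hlaw.map_eq, integrable_map_measure hz.aestronglyMeasurable hlaw.aemeasurable]
    exact N.integrable_normSq_hx_mul_quantError.const_mul _
  have hsq : ∀ ω, N.leakage (N.hx ω, N.U ω) ^ 2 =
      p.thetaS ^ 2 * (‖N.hx ω‖ ^ 4 * N.quantError ω ^ 2) := by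
    intro ω
    change (p.thetaS * (‖N.hx ω‖ ^ 2 * N.quantError ω)) ^ 2 = _
    ring
  have hz2 : Integrable (fun x => N.leakage x ^ 2)
      ((complexGaussianVector p.L p.lam).prod (μ.map N.U)) := by
    rw [← hlaw.map_eq, integrable_map_measure (hz.pow_const 2).aestronglyMeasurable
      hlaw.aemeasurable]
    refine (N.integrable_norm_hx_pow 4 |>.const_mul (p.thetaS ^ 2)).mono'
      ((hz.comp_aemeasurable hlaw.aemeasurable).pow_const 2).aestronglyMeasurable ?_
    filter_upwards [hpos] with ω h
    rw [Function.comp_apply, hsq, Real.norm_of_nonneg (by positivity)]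
    have := pow_le_one₀ (n := 2) h.le (N.quantError_le_one ω)
    gcongr
    exact mul_le_of_le_one_right (by positivity) this
  have hmain := abs_measureReal_outage_sub_le
    ((complexGaussianVector (p.L - 1) 1).map (fun h => ‖h‖ ^ 2)) _ ha0 hb0 hz hz0 hz1 hz2
  have hLn : ((p.L - 1 : ℕ) : ℝ) = (p.L : ℝ) - 1 := by
    rw [Nat.cast_sub (by omega), Nat.cast_one]
  have hLn' : (p.L : ℝ) - 1 - 1 = (p.L : ℝ) - 2 := by ring
  have hIz : ∫ x, N.leakage x ∂(complexGaussianVector p.L p.lam).prod (μ.map N.U) =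
      p.thetaS * (p.L * p.lam * ∫ ω, N.quantError ω ∂μ) := by
    rw [← hlaw.integral_comp hz.aestronglyMeasurable, ← N.integral_normSq_hx_mul_quantError,
      ← integral_const_mul]
    rfl
  have hIz2 : ∫ x, N.leakage x ^ 2 ∂(complexGaussianVector p.L p.lam).prod (μ.map N.U) =
      p.thetaS ^ 2 * ∫ ω, ‖N.hx ω‖ ^ 4 * N.quantError ω ^ 2 ∂μ := by
    rw [← hlaw.integral_comp (f := fun x => N.leakage x ^ 2)
      (hz.pow_const 2).aestronglyMeasurable, ← integral_const_mul]
    exact integral_congr_ae (Filter.Eventually.of_forall hsq)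
  rw [← N.outageProb_eq hpos, hIz, hIz2, ← Set.compl_Ioi,
    probReal_compl_eq_one_sub measurableSet_Ioi,
    measureReal_Ioi_map_normSq_complexGaussianVector (by omega) ha0,
    integral_indicator_inv_map_normSq_complexGaussianVector (by omega) ha0, hLn, hLn'] at hmain
  exact hmain

theorem abs_outageProb_sub_le_of_cdf (N : OCBLink p μ V) {K δ : ℝ} (hδ0 : 0 ≤ δ)
    (hK : K * δ ^ (p.L - 1) = 1)
    (h : ∀ t, 0 ≤ t → t ≤ δ → μ.real {ω | N.quantError ω ≤ t} = K * t ^ (p.L - 1)) :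
    |N.outageProb - (1 - upperGamma ((p.L : ℝ) - 1) (p.thetaS / p.gammaMax) /
        Real.Gamma ((p.L : ℝ) - 1) + p.phi * δ)| ≤
      (p.thetaP / p.gammaP) ^ 2 / (2 * (p.thetaS / p.gammaMax) ^ 2) *
        (p.thetaS ^ 2 * ∫ h, ‖h‖ ^ 4 ∂complexGaussianVector p.L p.lam) * δ ^ 2 := by
  have hL2 := p.two_le_L
  have hLn : ((p.L - 1 : ℕ) : ℝ) = (p.L : ℝ) - 1 := by
    rw [Nat.cast_sub (by omega), Nat.cast_one]
  have hL0 : 0 < (p.L : ℝ) - 1 := by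
    rw [← hLn]
    exact_mod_cast (by omega : 0 < p.L - 1)
  have hεm := N.aemeasurable_quantError
  have hm : p.L - 1 ≠ 0 := by omega
  have hpos := ae_pos_of_measureReal_le_eq hδ0 hm h
  have hle := ae_le_of_measureReal_le_eq hεm hδ0 hK h
  have hmain := N.abs_outageProb_sub_le hpos
  rw [integral_of_measureReal_le_eq hεm hδ0 hm hK h, hLn] at hmain
  -- The `L` from `E[‖hx‖²] = Lλ` cancels the denominator of `E[ε] = δ (L-1)/L`.
  have hphi : Real.exp (-(p.thetaP / p.gammaP)) * (p.thetaP / p.gammaP) *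
        (upperGamma ((p.L : ℝ) - 2) (p.thetaS / p.gammaMax) / Real.Gamma ((p.L : ℝ) - 1) *
          (p.thetaS * (p.L * p.lam * (δ * (((p.L : ℝ) - 1) / ((p.L : ℝ) - 1 + 1)))))) =
      p.phi * δ := by
    have hΓ : Real.Gamma ((p.L : ℝ) - 1) ≠ 0 := (Real.Gamma_pos_of_pos hL0).ne'
    have hγ := p.gammaP_pos.ne'
    have hL : (p.L : ℝ) ≠ 0 := by linarith
    rw [CRParams.phi, sub_add_cancel]
    field_simp
  rw [hphi] at hmain
  refine hmain.trans ?_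
  -- Here `0 < ε ≤ δ` almost surely, so no independence is needed for the remainder.
  have hint : ∫ ω, ‖N.hx ω‖ ^ 4 * N.quantError ω ^ 2 ∂μ ≤
      (∫ h, ‖h‖ ^ 4 ∂complexGaussianVector p.L p.lam) * δ ^ 2 := by
    rw [← N.law_hx.integral_comp (f := fun h => ‖h‖ ^ 4)
      (Measurable.aestronglyMeasurable (by fun_prop)), ← integral_mul_const]
    refine integral_mono_of_nonneg (Filter.Eventually.of_forall fun ω => by positivity)
      ((N.integrable_norm_hx_pow 4).mul_const _) ?_
    filter_upwards [hpos, hle] with ω h1 h2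
    simp only [Function.comp_apply]
    gcongr
  rw [mul_assoc, mul_assoc (p.thetaS ^ 2)]
  gcongr

end Probability

end OCBLink

theorem mainTheorem1 (p : CRParams) :
    ∃ C : ℝ, ∀ (B : ℕ) (Ω : Type u) [MeasurableSpace Ω] (μ : Measure Ω) [IsProbabilityMeasure μ]
      (V : Type v) [MeasurableSpace V] (N : OCBLink p μ V), N.IsBBitFeedback B →
      |N.outageProb -
        (1 - upperGamma ((p.L : ℝ) - 1) (p.thetaS / p.gammaMax) / Real.Gamma ((p.L : ℝ) - 1)
          + p.phi * (2 : ℝ) ^ (-((B : ℝ) / ((p.L : ℝ) - 1))))|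
        ≤ C * (2 : ℝ) ^ (-(2 * (B : ℝ) / ((p.L : ℝ) - 1))) := by
  have hL2 := p.two_le_L
  have hLn : ((p.L - 1 : ℕ) : ℝ) = (p.L : ℝ) - 1 := by
    rw [Nat.cast_sub (by omega), Nat.cast_one]
  have hL0 : (p.L : ℝ) - 1 ≠ 0 := by
    rw [← hLn]
    exact_mod_cast (by omega : p.L - 1 ≠ 0)
  -- The constant `b²/(2a²) · θ_s² E[‖h_x‖⁴]` involves the network parameters only, not `B`, the
  -- quantizer or the probability space.
  refine ⟨(p.thetaP / p.gammaP) ^ 2 / (2 * (p.thetaS / p.gammaMax) ^ 2) *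
    (p.thetaS ^ 2 * ∫ h, ‖h‖ ^ 4 ∂complexGaussianVector p.L p.lam),
    fun B Ω _ μ _ V _ N hB => ?_⟩
  have hδ2 : (2 : ℝ) ^ (-(2 * (B : ℝ) / ((p.L : ℝ) - 1))) =
      ((2 : ℝ) ^ (-((B : ℝ) / ((p.L : ℝ) - 1)))) ^ 2 := by
    rw [← Real.rpow_mul_natCast two_pos.le]
    congr 1
    push_cast
    ring
  -- The distribution function reaches `1` at the end of its range, so the error is almost surely at
  -- most `2^(-B/(L-1))`.
  have hK : (2 : ℝ) ^ B * ((2 : ℝ) ^ (-((B : ℝ) / ((p.L : ℝ) - 1)))) ^ (p.L - 1) = 1 := by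
    rw [← Real.rpow_mul_natCast two_pos.le, ← Real.rpow_natCast, ← Real.rpow_add two_pos, hLn,
      neg_mul, div_mul_cancel₀ _ hL0, add_neg_cancel, Real.rpow_zero]
  rw [hδ2]
  exact N.abs_outageProb_sub_le_of_cdf (by positivity) hK hB
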